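/- Let $V$ be a finite set of $n$ peers. Each peer $v$ has a demand $d_v \ge 0$, each peer $u$ has a cost $c_u \ge 0$ per unit of demand served, and $P=(p_{v,u})_{v,u\in V}$ is a (not necessarily symmetric) matrix of non-negative connection qualities. Put $C_u := c_u\sum_{v} d_v$. Each peer $u$ is offered a payment $\pi_u > 0$ with $\pi_u \ge C_u$, and has a tradeoff factor $\lambda_u$; the $\lambda_u$ are independent and uniformly distributed on $[0,1]$. If $A$ is the set of sharing peers, a peer $u\in A$ has utility \[ \lambda_u\pi_u - c_u\sum_{v}\frac{d_v\,p_{v,u}}{\sum_{w\in A}p_{v,w}} \] (terms with $p_{v,u}=0$ being $0$), and a peer $u \notin A$ has utility $0$. The sharing process starts with $A_0=\emptyset$; in iteration $t+1$ all peers decide simultaneously, and $A_{t+1}$ is the set of those $u$ whose utility would be positive if the set of sharing peers were $A_t\cup\{u\}$. The sets $A_t$ increase, and the process ends in an equilibrium $S$, which is a random set depending on $\pi=(\pi_u)_{u\in V}$. Let $W$ be a real-valued function of subsets of $V$ that is monotone ($W(S)\le W(T)$ for $S\subseteq T$) and submodular ($W(T\cup\{v\})-W(T)\le W(S\cup\{v\})-W(S)$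 for $S\subseteq T$ and $v\notin T$). Then the expected welfare $g(\pi)=\mathbb{E}[W(S)]$, as a function on the set of all $\pi$ with $\pi_u>0$ and $\pi_u\ge C_u$ for every $u$, is well defined, is monotone non-decreasing in the payments, and has diminishing returns: for all $i,j\in V$ (including $i=j$) the second partial derivative $\frac{\partial^2 g}{\partial\pi_i\,\partial\pi_j}$ exists and is $\le 0$ everywhere on this set, where derivatives with respect to $\pi_u$ at the boundary $\pi_u=C_u$ are one-sided. -/

import Mathlib

open MeasureTheory

/-- The data of the demand model on a finite set `V` of peers: `demand v` is the demand for the file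
originating at `v`, `cost u` is the cost to `u` per unit of demand that it serves, and `quality v u`
is the quality of the connection between `v` and `u` (the larger it is, the larger the fraction of
the demand of `v` that `u` serves when it shares). The matrix `quality` need not be symmetric. -/
structure DemandModel (V : Type*) where
  demand : V → ℝ
  cost : V → ℝ
  quality : V → V → ℝ
  demand_nonneg : ∀ v, 0 ≤ demand v
  cost_nonneg : ∀ u, 0 ≤ cost u
  quality_nonneg : ∀ v u, 0 ≤ quality v u

namespace DemandModel

variable {V : Type*} [Fintype V] [DecidableEq V]

/-- The demand that a sharing peer `u ∈ A` sees from `v` when `A` is the set of sharing peers.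
If the denominator vanishes then `quality v u = 0` as well, and `v` sends no demand to `u`. -/
noncomputable def load (M : DemandModel V) (A : Finset V) (v u : V) : ℝ :=
  M.demand v * M.quality v u / ∑ w ∈ A, M.quality v w

/-- The sharing utility of the peer `u ∈ A` when `A` is the set of sharing peers, `pay` is the
vector of payment offers and `r` is the vector of money/bandwidth tradeoff factors. -/
noncomputable def utility (M : DemandModel V) (pay r : V → ℝ) (A : Finset V) (u : V) : ℝ :=
  r u * pay u - M.cost u * ∑ v, M.load A v u

/-- One iteration: simultaneously, every peer shares exactly if sharing gives it positive utility
(not sharing gives utility `0`), given the previous decisions `A` of the other peers. -/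
noncomputable def step (M : DemandModel V) (pay r : V → ℝ) (A : Finset V) : Finset V :=
  Finset.univ.filter fun u => 0 < M.utility pay r (insert u A) u

/-- The set of sharing peers at the end of the sharing process, which starts with no sharing peers.
An equilibrium is reached after at most `|V|` iterations, see `step_finalSet`. -/
noncomputable def finalSet (M : DemandModel V) (pay r : V → ℝ) : Finset V :=
  (M.step pay r)^[Fintype.card V] ∅

theorem load_anti (M : DemandModel V) {A B : Finset V} (h : A ⊆ B) (v u : V) :
    M.load (insert u B) v u ≤ M.load (insert u A) v u := by
  unfold load
  have h0 := M.quality_nonneg v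
  have hd := M.demand_nonneg v
  rcases (h0 u).eq_or_lt with hu | hu
  · simp [← hu]
  · have hpos : 0 < ∑ w ∈ insert u A, M.quality v w :=
      Finset.sum_pos' (fun w _ => h0 w) ⟨u, Finset.mem_insert_self u A, hu⟩
    exact div_le_div_of_nonneg_left (mul_nonneg hd (h0 u)) hpos
      (Finset.sum_le_sum_of_subset_of_nonneg (Finset.insert_subset_insert u h)
        fun w _ _ => h0 w)

theorem step_mono (M : DemandModel V) (pay r : V → ℝ) : Monotone (M.step pay r) := by
  intro A B h u hu
  have hu' := (Finset.mem_filter.1 hu).2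
  refine Finset.mem_filter.2 ⟨Finset.mem_univ u, ?_⟩
  unfold utility at hu' ⊢
  have := mul_le_mul_of_nonneg_left
    (Finset.sum_le_sum fun v (_ : v ∈ Finset.univ) => M.load_anti h v u) (M.cost_nonneg u)
  linarith

/-- The final set is an equilibrium of the process. -/
theorem step_finalSet (M : DemandModel V) (pay r : V → ℝ) :
    M.step pay r (M.finalSet pay r) = M.finalSet pay r := by
  set f := M.step pay r with hf
  have hmono : Monotone fun t => f^[t] ∅ :=
    (M.step_mono pay r).monotone_iterate_of_le_map (Finset.empty_subset _)
  have key : ∀ t, f (f^[t] ∅) = f^[t] ∅ ∨ t + 1 ≤ (f^[t + 1] ∅).card := by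
    intro t
    induction t with
    | zero =>
      by_cases h : f ∅ = ∅
      · exact Or.inl h
      · right
        simpa [Nat.succ_le_iff, Finset.card_pos, Finset.nonempty_iff_ne_empty] using h
    | succ t ih =>
      rcases ih with ih | ih
      · left
        rw [Function.iterate_succ_apply', ih, ih]
      · by_cases h : f (f^[t + 1] ∅) = f^[t + 1] ∅
        · exact Or.inl h
        · right
          have hss : f^[t + 1] ∅ ⊂ f^[t + 1 + 1] ∅ := by
            refine (hmono (Nat.le_succ (t + 1))).lt_of_ne fun e => h ?_
            rw [← Function.iterate_succ_apply' f]
            exact e.symm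
          have := Finset.card_lt_card hss
          omega
  rcases key (Fintype.card V) with h | h
  · exact h
  · have := Finset.card_le_univ (f^[Fintype.card V + 1] ∅)
    omega

/-- The law of the tradeoff factors: independent and uniformly distributed on `[0, 1]`. -/
noncomputable def tradeoffLaw (V : Type*) [Fintype V] : Measure (V → ℝ) :=
  Measure.pi fun _ => volume.restrict (Set.Icc (0 : ℝ) 1)

/-- The expected social welfare, as a function of the vector of payment offers. -/
noncomputable def expectedWelfare (M : DemandModel V) (W : Finset V → ℝ) (pay : V → ℝ) : ℝ :=
  ∫ r, W (M.finalSet pay r) ∂(tradeoffLaw V)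

/-- The largest cost `cost u * ∑ v, demand v` that the peer `u` may have to bear. -/
noncomputable def maxCost (M : DemandModel V) (u : V) : ℝ :=
  M.cost u * ∑ v, M.demand v

/-- The payments that may be offered to the peer `u`: positive, and at least `maxCost u`. -/
def offers (M : DemandModel V) (u : V) : Set ℝ :=
  {t | M.maxCost u ≤ t ∧ 0 < t}

end DemandModel

/-- Submodular set functions: adding an element to a larger set causes an increase that is at most
the increase caused by adding it to a smaller set. -/
def IsSubmodular {V : Type*} [DecidableEq V] (f : Finset V → ℝ) : Prop :=
  ∀ S T : Finset V, S ⊆ T → ∀ v, v ∉ T → f (insert v T) - f T ≤ f (insert v S) - f S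

/-- The partial derivative in the `i`-th coordinate of a function `g` on the box `∏ i, D i`. When
`D i` is an interval, it is the usual one in the interior and one-sided at an end point. -/
noncomputable def partialDerivOn {V : Type*} [DecidableEq V] (D : V → Set ℝ) (i : V)
    (g : (V → ℝ) → ℝ) (x : V → ℝ) : ℝ :=
  derivWithin (fun t => g (Function.update x i t)) (D i) (x i)

/-- Existence of the partial derivative `partialDerivOn D i g x`. -/
def HasPartialOn {V : Type*} [DecidableEq V] (D : V → Set ℝ) (i : V)
    (g : (V → ℝ) → ℝ) (x : V → ℝ) : Prop :=
  DifferentiableWithinAt ℝ (fun t => g (Function.update x i t)) (D i) (x i)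

/-- Diminishing returns on the box `∏ i, D i`: all second partial derivatives, pure and mixed,
exist and are nonpositive. -/
def DiminishingReturnsOn {V : Type*} [DecidableEq V] (D : V → Set ℝ) (g : (V → ℝ) → ℝ) : Prop :=
  ∀ x ∈ Set.univ.pi D, ∀ i j,
    HasPartialOn D j g x ∧
    HasPartialOn D i (partialDerivOn D j g) x ∧
    partialDerivOn D i (partialDerivOn D j g) x ≤ 0

/-! Payments enter the sharing process only through their reciprocals: peer `u` joins the set `A` of
sharing peers when `q u * joinCost u A < r u`, where `q u = (pay u)⁻¹`. As `joinCost u` is antitone,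
the final set is the smallest set that is closed under joining (`cascade`).

For fixed factors `r v` with `v ≠ i`, the final set takes one of two values `A ⊆ B`, depending on
whether `i` joins `A` (`cascade_eq_ite`). Integrating out `r i`, which is uniform on `[0, 1]`, shows
that the expected welfare is affine in `q i`, with nonpositive slope
(`exists_scaledValue_update_eq`); the condition `maxCost i ≤ pay i` is what keeps the probability
`q i * joinCost i A` of refusing within `[0, 1]`. So the welfare is `a - b / pay i` with `0 ≤ b`,
which gives the pure second derivatives. In two coordinates it is
`a + b * q i + c * q j + d * q i * q j`, whose mixed second derivative in the payments has the sign
of `d`. By interpolation from `q i = 0` and `q j = 0`, where `i` or `j` joins unconditionally,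
`d ≤ 0` amounts to submodularity of the expected welfare in the set of peers that are forced to
share (`integral_cascade_submodular`).

That is the theorem of Mossel and Roch on threshold models, and it is proved by their coupling. Let
`A` be the final set without forced peers and `B` the one with `i` forced, both for `r`. Reflecting
`r v` in the interval `[0, q v * joinCost v A]` for all `v ∉ A` preserves the law of `r` and the set
`A`, since `v ∉ A` says precisely that `r v` lies in this interval
(`measurePreserving_reflect_cascade`). Let `C` be the final set with `j` forced for these reflected
factors, and `D` the one with both forced for the factors reflected outside `B`. After reflection,
`v ∉ B ∪ C` implies `q v * (joinCost v A - joinCost v C) ≤ r v`, whereas `v` joins `B ∪ C` in the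
construction of `D` only if `r v < q v * (joinCost v B - joinCost v (B ∪ C))`. By supermodularity of
`joinCost v` these exclude each other. Hence `D ⊆ B ∪ C`, while `A ⊆ B ∩ C`, and submodularity
of `W` applies pointwise. -/

section

variable {V : Type*} [Fintype V] [DecidableEq V]

/-! ### Threshold cascades -/

/-- The final set of the cascade in which `u` joins once its resistance `h u A` to the set `A` of
earlier participants is below its threshold `r u`. It is encoded as the intersection of all sets
closed under joining. -/
noncomputable def cascade (h : V → Finset V → ℝ) (r : V → ℝ) : Finset V :=
  Finset.univ.filter fun v => ∀ X : Finset V, (∀ u, h u X < r u → u ∈ X) → v ∈ X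

theorem cascade_subset {h : V → Finset V → ℝ} {r : V → ℝ} {X : Finset V}
    (hX : ∀ u, h u X < r u → u ∈ X) : cascade h r ⊆ X :=
  fun _ hv => (Finset.mem_filter.1 hv).2 X hX

theorem mem_cascade_of_lt {h : V → Finset V → ℝ} (hh : ∀ u, Antitone (h u)) {r : V → ℝ} {u : V}
    (hu : h u (cascade h r) < r u) : u ∈ cascade h r :=
  Finset.mem_filter.2 ⟨Finset.mem_univ u, fun _ hX => hX u ((hh u (cascade_subset hX)).trans_lt hu)⟩

/-- Lower resistances lead to a larger cascade. -/
theorem cascade_subset_cascade {h h' : V → Finset V → ℝ} (hh' : ∀ u, Antitone (h' u))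
    (hle : ∀ u A, h' u A ≤ h u A) (r : V → ℝ) : cascade h r ⊆ cascade h' r :=
  cascade_subset fun u hu => mem_cascade_of_lt hh' ((hle u _).trans_lt hu)

omit [Fintype V] in
theorem antitone_update_zero {h : V → Finset V → ℝ} (hh : ∀ u, Antitone (h u)) (i u : V) :
    Antitone (Function.update h i 0 u) := by
  rcases eq_or_ne u i with rfl | hu
  · rw [Function.update_self]
    exact antitone_const
  · simpa [hu] using hh u

omit [Fintype V] in
theorem update_zero_le {h : V → Finset V → ℝ} (h0 : ∀ u A, 0 ≤ h u A) (i u : V)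
    (A : Finset V) : Function.update h i 0 u A ≤ h u A := by
  rcases eq_or_ne u i with rfl | hu
  · simpa using h0 u A
  · simp [hu]

/-- The cascade depends on the threshold and the resistance of `i` only through the decision
whether `i` joins the cascade that the others produce without `i`. With the resistance of `i` put
to `0`, the threshold `0` keeps `i` out and the threshold `1` makes `i` join at once. -/
theorem cascade_eq_ite {h : V → Finset V → ℝ} (hh : ∀ u, Antitone (h u)) (r : V → ℝ) (i : V) :
    cascade h r =
      if h i (cascade (Function.update h i 0) (Function.update r i 0)) < r i then
        cascade (Function.update h i 0) (Function.update r i 1)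
      else cascade (Function.update h i 0) (Function.update r i 0) := by
  have hh0 := antitone_update_zero hh i
  set A := cascade (Function.update h i 0) (Function.update r i 0) with hA
  set B := cascade (Function.update h i 0) (Function.update r i 1) with hB
  have hAS : A ⊆ cascade h r := by
    refine cascade_subset fun u hu => ?_
    rcases eq_or_ne u i with rfl | hui
    · simp at hu
    · exact mem_cascade_of_lt hh (by simpa [hui] using hu)
  split_ifs with hi
  · apply Finset.Subset.antisymm
    · refine cascade_subset fun u hu => ?_
      refine mem_cascade_of_lt hh0 ?_
      rcases eq_or_ne u i with rfl | hui
      · simp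
      · simpa [hui] using hu
    · refine cascade_subset fun u hu => ?_
      rcases eq_or_ne u i with rfl | hui
      · exact mem_cascade_of_lt hh ((hh u hAS).trans_lt hi)
      · exact mem_cascade_of_lt hh (by simpa [hui] using hu)
  · refine Finset.Subset.antisymm (cascade_subset fun u hu => ?_) hAS
    rcases eq_or_ne u i with rfl | hui
    · exact absurd hu hi
    · exact mem_cascade_of_lt hh0 (by simpa [hui] using hu)

theorem measurable_comp_cascade {β : Type*} [MeasurableSpace β] (h : V → Finset V → ℝ)
    (φ : Finset V → β) : Measurable fun r => φ (cascade h r) := by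
  classical
  -- The cascade is a function of the finitely many truth values of `h u X < r u`.
  let Φ : (V → Finset V → Prop) → β := fun P =>
    φ (Finset.univ.filter fun v => ∀ X : Finset V, (∀ u, P u X → u ∈ X) → v ∈ X)
  have hΦ : Measurable Φ := Measurable.of_discrete
  have hP : Measurable fun (r : V → ℝ) (u : V) (X : Finset V) => h u X < r u :=
    measurable_pi_lambda _ fun u => measurable_pi_lambda _ fun X =>
      measurableSet_setOfPred.1 (measurableSet_lt measurable_const (measurable_pi_apply u))
  have heq : (fun r => φ (cascade h r)) = Φ ∘ fun r u X => h u X < r u := by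
    funext r
    simp only [Φ, Function.comp, cascade]
  rw [heq]
  exact hΦ.comp hP

/-! ### The law of the thresholds -/

instance : IsProbabilityMeasure (volume.restrict (Set.Icc (0 : ℝ) 1)) :=
  ⟨by simp⟩

instance : IsProbabilityMeasure (DemandModel.tradeoffLaw V) := by
  unfold DemandModel.tradeoffLaw
  infer_instance

omit [DecidableEq V] in
theorem tradeoffLaw_eq_restrict :
    DemandModel.tradeoffLaw V = volume.restrict (Set.univ.pi fun _ => Set.Icc (0 : ℝ) 1) := by
  rw [DemandModel.tradeoffLaw, ← Measure.restrict_pi_pi, volume_pi]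

omit [DecidableEq V] in
theorem ae_tradeoffLaw_mem_Icc :
    ∀ᵐ r ∂(DemandModel.tradeoffLaw V), ∀ u, r u ∈ Set.Icc (0 : ℝ) 1 := by
  rw [tradeoffLaw_eq_restrict]
  filter_upwards [ae_restrict_mem (MeasurableSet.univ_pi fun _ => measurableSet_Icc)] with r hr u
  exact hr u (Set.mem_univ u)

omit [DecidableEq V] in
theorem ae_tradeoffLaw_pos (i : V) : ∀ᵐ r ∂(DemandModel.tradeoffLaw V), 0 < r i := by
  have hpos : ∀ᵐ t ∂(volume.restrict (Set.Icc (0 : ℝ) 1)), 0 < t := by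
    filter_upwards [ae_restrict_mem measurableSet_Icc, Measure.ae_ne _ (0 : ℝ)] with t ht ht0
    exact lt_of_le_of_ne ht.1 ht0.symm
  exact (measurePreserving_eval (fun _ : V => volume.restrict (Set.Icc (0 : ℝ) 1))
    i).quasiMeasurePreserving.ae hpos

theorem integrable_tradeoffLaw_comp_cascade (h : V → Finset V → ℝ) (φ : Finset V → ℝ) :
    Integrable (fun r => φ (cascade h r)) (DemandModel.tradeoffLaw V) :=
  Integrable.of_bound (measurable_comp_cascade h φ).aestronglyMeasurable (∑ T, |φ T|)
    (Filter.Eventually.of_forall fun _ =>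
      Finset.single_le_sum (f := fun T => |φ T|) (fun _ _ => abs_nonneg _) (Finset.mem_univ _))

/-- Resampling one coordinate does not change the law of the thresholds. -/
theorem measurePreserving_update_tradeoffLaw (i : V) :
    MeasurePreserving (fun x : (V → ℝ) × ℝ => Function.update x.1 i x.2)
      ((DemandModel.tradeoffLaw V).prod (volume.restrict (Set.Icc (0 : ℝ) 1)))
      (DemandModel.tradeoffLaw V) := by
  have hmeas : Measurable fun x : (V → ℝ) × ℝ => Function.update x.1 i x.2 := by
    refine measurable_pi_lambda _ fun u => ?_
    rcases eq_or_ne u i with rfl | hu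
    · simpa using measurable_snd
    · simpa [hu] using (measurable_pi_apply (X := fun _ : V => ℝ) u).fun_comp measurable_fst
  refine ⟨hmeas, ?_⟩
  symm
  refine Measure.pi_eq fun s hs => ?_
  rw [Measure.map_apply hmeas (MeasurableSet.univ_pi hs)]
  have hpre : (fun x : (V → ℝ) × ℝ => Function.update x.1 i x.2) ⁻¹' Set.univ.pi s =
      (Set.univ.pi (Function.update s i Set.univ)) ×ˢ s i := by
    ext x
    simp only [Set.mem_preimage, Set.mem_pi, Set.mem_univ, true_implies, Set.mem_prod]
    constructor
    · intro hx
      refine ⟨fun u => ?_, by simpa using hx i⟩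
      rcases eq_or_ne u i with rfl | hu
      · simp
      · simpa [hu] using hx u
    · rintro ⟨hx, hi⟩ u
      rcases eq_or_ne u i with rfl | hu
      · simpa using hi
      · simpa [hu] using hx u
  rw [hpre, Measure.prod_prod, DemandModel.tradeoffLaw, Measure.pi_pi,
    ← Finset.prod_erase_mul _ _ (Finset.mem_univ i),
    ← Finset.prod_erase_mul _ _ (Finset.mem_univ i)]
  simp only [Function.update_self, measure_univ, mul_one]
  congr 1
  refine Finset.prod_congr rfl fun u hu => ?_
  rw [Function.update_of_ne (Finset.ne_of_mem_erase hu)]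

/-- The expectation of a function of the cascade, after integrating out the threshold of `i`. The
right-hand side involves the resistance `h i` only as a linear factor. -/
theorem integral_cascade_eq {h : V → Finset V → ℝ} (hh : ∀ u, Antitone (h u))
    (h0 : ∀ u A, 0 ≤ h u A) (h1 : ∀ u A, h u A ≤ 1) (W : Finset V → ℝ) (i : V) :
    ∫ r, W (cascade h r) ∂(DemandModel.tradeoffLaw V) =
      ∫ r, (W (cascade (Function.update h i 0) (Function.update r i 1)) -
        h i (cascade (Function.update h i 0) (Function.update r i 0)) *
          (W (cascade (Function.update h i 0) (Function.update r i 1)) -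
            W (cascade (Function.update h i 0) (Function.update r i 0))))
        ∂(DemandModel.tradeoffLaw V) := by
  have hmp := measurePreserving_update_tradeoffLaw (V := V) i
  have hint := integrable_tradeoffLaw_comp_cascade h W
  have hint' : Integrable (fun x : (V → ℝ) × ℝ => W (cascade h (Function.update x.1 i x.2)))
      ((DemandModel.tradeoffLaw V).prod (volume.restrict (Set.Icc (0 : ℝ) 1))) :=
    hmp.integrable_comp_of_integrable hint
  conv_lhs => rw [← hmp.map_eq]
  rw [integral_map hmp.measurable.aemeasurable
    (by rw [hmp.map_eq]; exact hint.aestronglyMeasurable), integral_prod _ hint']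
  refine integral_congr_ae (Filter.Eventually.of_forall fun r => ?_)
  dsimp only
  set A := cascade (Function.update h i 0) (Function.update r i 0) with hA
  set B := cascade (Function.update h i 0) (Function.update r i 1) with hB
  have hval : ∀ t : ℝ, W (cascade h (Function.update r i t)) =
      (Set.Ioi (h i A)).indicator (fun _ => W B - W A) t + W A := by
    intro t
    rw [cascade_eq_ite hh _ i]
    simp only [Function.update_idem, Function.update_self, ← hA, ← hB, Set.indicator, Set.mem_Ioi]
    split_ifs <;> ring
  have hvol : (volume.restrict (Set.Icc (0 : ℝ) 1)).real (Set.Ioi (h i A)) = 1 - h i A := by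
    rw [measureReal_restrict_apply measurableSet_Ioi]
    have : Set.Ioi (h i A) ∩ Set.Icc 0 1 = Set.Ioc (h i A) 1 := by
      ext t
      simp only [Set.mem_inter_iff, Set.mem_Ioi, Set.mem_Icc, Set.mem_Ioc]
      exact ⟨fun ht => ⟨ht.1, ht.2.2⟩, fun ht => ⟨ht.1, (h0 i A).trans ht.1.le, ht.2⟩⟩
    rw [this, Real.volume_real_Ioc_of_le (h1 i A)]
  simp only [hval]
  rw [integral_add ((integrable_const _).indicator measurableSet_Ioi) (integrable_const _),
    integral_indicator_const _ measurableSet_Ioi, hvol]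
  simp
  ring

/-! ### Reflection of the thresholds outside the final set -/

/-- Gluing measure-preserving maps along the fibres of a function with finitely many values. -/
theorem measurePreserving_restrict_of_fiberwise {α ι : Type*} [MeasurableSpace α] [Fintype ι]
    {ν : Measure α} {K : Set α} (hK : MeasurableSet K) {p : α → ι}
    (hp : ∀ T, MeasurableSet (p ⁻¹' {T})) {f : ι → α → α} (hf : ∀ T, MeasurePreserving (f T) ν ν)
    (hfK : ∀ T, f T ⁻¹' (K ∩ p ⁻¹' {T}) = K ∩ p ⁻¹' {T}) :
    MeasurePreserving (fun x => f (p x) x) (ν.restrict K) (ν.restrict K) := by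
  have hpre : ∀ s T, (fun x => f (p x) x) ⁻¹' s ∩ p ⁻¹' {T} = f T ⁻¹' s ∩ p ⁻¹' {T} := by
    intro s T
    ext x
    simp only [Set.mem_inter_iff, Set.mem_preimage, Set.mem_singleton_iff]
    constructor <;> rintro ⟨hx, rfl⟩ <;> exact ⟨hx, rfl⟩
  have hmeas : Measurable fun x => f (p x) x := by
    intro s hs
    have : (fun x => f (p x) x) ⁻¹' s = ⋃ T, f T ⁻¹' s ∩ p ⁻¹' {T} := by
      simp_rw [← hpre, ← Set.inter_iUnion]
      ext x
      simp
    rw [this]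
    exact MeasurableSet.iUnion fun T => ((hf T).measurable hs).inter (hp T)
  have hsum : ∀ s, MeasurableSet s → ν.restrict K s = ∑ T, ν (s ∩ p ⁻¹' {T} ∩ K) := by
    intro s hs
    have := sum_measure_preimage_singleton (μ := (ν.restrict K).restrict s) Finset.univ
      fun T _ => hp T
    rw [Finset.coe_univ, Set.preimage_univ, Measure.restrict_apply_univ] at this
    rw [← this]
    refine Finset.sum_congr rfl fun T _ => ?_
    rw [Measure.restrict_apply (hp T), Measure.restrict_apply ((hp T).inter hs), Set.inter_comm s]
  refine ⟨hmeas, Measure.ext fun s hs => ?_⟩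
  rw [Measure.map_apply hmeas hs, hsum _ (hmeas hs), hsum s hs]
  refine Finset.sum_congr rfl fun T _ => ?_
  rw [hpre, Set.inter_assoc, Set.inter_comm _ K, ← hfK T, ← Set.preimage_inter,
    (hf T).measure_preimage (hs.inter (hK.inter (hp T))).nullMeasurableSet, Set.inter_assoc,
    Set.inter_comm _ K]

/-- Outside of `T`, reflect the threshold `r v` in the interval `[0, h v T]`. -/
def reflectOutside (h : V → Finset V → ℝ) (T : Finset V) (r : V → ℝ) (v : V) : ℝ :=
  if v ∈ T then r v else h v T - r v

omit [Fintype V] in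
theorem reflectOutside_involutive (h : V → Finset V → ℝ) (T : Finset V) :
    Function.Involutive (reflectOutside h T) := by
  intro r
  funext v
  unfold reflectOutside
  split_ifs <;> ring

theorem measurePreserving_reflectOutside (h : V → Finset V → ℝ) (T : Finset V) :
    MeasurePreserving (reflectOutside h T) volume volume := by
  refine volume_preserving_pi (f := fun v x => if v ∈ T then x else h v T - x) fun v => ?_
  by_cases hv : v ∈ T
  · simp only [hv, if_true]
    exact MeasurePreserving.id volume
  · simpa [hv] using Measure.measurePreserving_sub_left volume (h v T)

/-- Reflecting the thresholds outside the final set does not change the final set: the thresholds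
of the members stay the same, and the others still refuse to join. -/
theorem cascade_reflectOutside {h : V → Finset V → ℝ} (hh : ∀ u, Antitone (h u)) {r : V → ℝ}
    (hr : ∀ u, 0 ≤ r u) : cascade h (reflectOutside h (cascade h r) r) = cascade h r := by
  set A := cascade h r with hA
  have hsub : cascade h (reflectOutside h A r) ⊆ A := by
    refine cascade_subset fun u hu => ?_
    by_contra huA
    rw [reflectOutside, if_neg huA] at hu
    linarith [hr u]
  refine Finset.Subset.antisymm hsub (cascade_subset fun u hu => ?_)
  have huA : u ∈ A := mem_cascade_of_lt hh ((hh u hsub).trans_lt hu)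
  exact mem_cascade_of_lt hh (by rwa [reflectOutside, if_pos huA])

theorem measurePreserving_reflect_cascade {h : V → Finset V → ℝ} (hh : ∀ u, Antitone (h u))
    (h1 : ∀ u A, h u A ≤ 1) :
    MeasurePreserving (fun r => reflectOutside h (cascade h r) r)
      (DemandModel.tradeoffLaw V) (DemandModel.tradeoffLaw V) := by
  rw [tradeoffLaw_eq_restrict]
  refine measurePreserving_restrict_of_fiberwise
    (MeasurableSet.univ_pi fun _ => measurableSet_Icc)
    (fun T => measurableSet_setOfPred.2 (measurable_comp_cascade h (· = T)))
    (measurePreserving_reflectOutside h) fun T => ?_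
  have hmaps : ∀ r ∈ (Set.univ.pi fun _ => Set.Icc (0 : ℝ) 1) ∩ cascade h ⁻¹' {T},
      reflectOutside h T r ∈ (Set.univ.pi fun _ => Set.Icc (0 : ℝ) 1) ∩ cascade h ⁻¹' {T} := by
    rintro r ⟨hr, rfl⟩
    refine ⟨fun v hv => ?_, cascade_reflectOutside hh fun u => (hr u (Set.mem_univ u)).1⟩
    unfold reflectOutside
    split_ifs with hvT
    · exact hr v hv
    · have hle : r v ≤ h v (cascade h r) := not_lt.1 fun hlt => hvT (mem_cascade_of_lt hh hlt)
      exact ⟨by linarith, by linarith [h1 v (cascade h r), (hr v hv).1]⟩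
  ext r
  refine ⟨fun hr => ?_, hmaps r⟩
  rw [← reflectOutside_involutive h T r]
  exact hmaps _ hr

/-! ### Submodularity in the set of initial participants -/

omit [Fintype V] in
/-- The union and intersection form of submodularity. -/
theorem IsSubmodular.union_add_inter_le {W : Finset V → ℝ} (hW : IsSubmodular W)
    (S T : Finset V) : W (S ∪ T) + W (S ∩ T) ≤ W S + W T := by
  have key : ∀ X A B : Finset V, A ⊆ B → Disjoint B X → W (B ∪ X) - W B ≤ W (A ∪ X) - W A := by
    intro X
    induction X using Finset.induction_on with
    | empty => intro A B _ _; simp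
    | insert x X hx ih =>
      intro A B hAB hd
      rw [Finset.disjoint_insert_right] at hd
      have hstep := hW (A ∪ X) (B ∪ X) (Finset.union_subset_union_left hAB) x (by simp [hx, hd.1])
      have := ih A B hAB hd.2
      rw [Finset.union_insert, Finset.union_insert]
      linarith
  have := key (S \ T) (S ∩ T) T Finset.inter_subset_right Finset.disjoint_sdiff
  rw [Finset.union_sdiff_self_eq_union, Finset.union_comm T S, Finset.union_comm (S ∩ T),
    Finset.sdiff_union_inter] at this
  linarith

/-- The expected value of the cascade is submodular in the set of initial participants, where
forcing `i` to participate means to put its resistance to `0`. The four cascades are coupled by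
reflected thresholds such that the one with both `i` and `j` forced is contained in the union of
those with one of them forced. -/
theorem integral_cascade_submodular {h : V → Finset V → ℝ} (hh : ∀ u, Antitone (h u))
    (h0 : ∀ u A, 0 ≤ h u A) (h1 : ∀ u A, h u A ≤ 1)
    (hsup : ∀ u A B C, A ⊆ B → h u B - h u (B ∪ C) ≤ h u A - h u (A ∪ C))
    {W : Finset V → ℝ} (hW_mono : Monotone W) (hW_sub : IsSubmodular W) (i j : V) :
    ∫ r, W (cascade (Function.update (Function.update h i 0) j 0) r) ∂(DemandModel.tradeoffLaw V) +
        ∫ r, W (cascade h r) ∂(DemandModel.tradeoffLaw V) ≤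
      ∫ r, W (cascade (Function.update h i 0) r) ∂(DemandModel.tradeoffLaw V) +
        ∫ r, W (cascade (Function.update h j 0) r) ∂(DemandModel.tradeoffLaw V) := by
  set hi := Function.update h i 0 with hhi
  set hj := Function.update h j 0 with hhj
  set hij := Function.update hi j 0 with hhij
  have mi : ∀ u, Antitone (hi u) := antitone_update_zero hh i
  have mj : ∀ u, Antitone (hj u) := antitone_update_zero hh j
  have li : ∀ u A, hi u A ≤ h u A := update_zero_le h0 i
  have lj : ∀ u A, hj u A ≤ h u A := update_zero_le h0 j
  have mpA := measurePreserving_reflect_cascade hh h1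
  have mpB := measurePreserving_reflect_cascade mi fun u A => (li u A).trans (h1 u A)
  have hintD := integrable_tradeoffLaw_comp_cascade hij W
  have hintC := integrable_tradeoffLaw_comp_cascade hj W
  have eD : ∫ r, W (cascade hij r) ∂(DemandModel.tradeoffLaw V) =
      ∫ r, W (cascade hij (reflectOutside hi (cascade hi r) r)) ∂(DemandModel.tradeoffLaw V) := by
    conv_lhs => rw [← mpB.map_eq]
    exact integral_map mpB.measurable.aemeasurable
      (by rw [mpB.map_eq]; exact hintD.aestronglyMeasurable)
  have eC : ∫ r, W (cascade hj r) ∂(DemandModel.tradeoffLaw V) =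
      ∫ r, W (cascade hj (reflectOutside h (cascade h r) r)) ∂(DemandModel.tradeoffLaw V) := by
    conv_lhs => rw [← mpA.map_eq]
    exact integral_map mpA.measurable.aemeasurable
      (by rw [mpA.map_eq]; exact hintC.aestronglyMeasurable)
  have hintD' : Integrable
      (fun r => W (cascade hij (reflectOutside hi (cascade hi r) r))) (DemandModel.tradeoffLaw V) :=
    mpB.integrable_comp_of_integrable hintD
  have hintC' : Integrable
      (fun r => W (cascade hj (reflectOutside h (cascade h r) r))) (DemandModel.tradeoffLaw V) :=
    mpA.integrable_comp_of_integrable hintC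
  have hintA := integrable_tradeoffLaw_comp_cascade h W
  have hintB := integrable_tradeoffLaw_comp_cascade hi W
  rw [eD, eC, ← integral_add hintD' hintA, ← integral_add hintB hintC']
  refine integral_mono_ae (hintD'.add hintA) (hintB.add hintC') ?_
  filter_upwards [ae_tradeoffLaw_mem_Icc, ae_tradeoffLaw_pos i,
    mpA.quasiMeasurePreserving.ae (ae_tradeoffLaw_pos j)] with r hr hri hrj
  set A := cascade h r with hA
  set B := cascade hi r with hB
  set C := cascade hj (reflectOutside h A r) with hC
  have hAB : A ⊆ B := cascade_subset_cascade mi li r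
  have hAC : A ⊆ C := by
    rw [hA, ← cascade_reflectOutside hh fun u => (hr u).1]
    exact cascade_subset_cascade mj lj _
  have hiB : i ∈ B := mem_cascade_of_lt mi (by simpa [hhi] using hri)
  have hjC : j ∈ C := mem_cascade_of_lt mj (by simpa [hhj] using hrj)
  have hD : cascade hij (reflectOutside hi B r) ⊆ B ∪ C := by
    refine cascade_subset fun u hu => ?_
    by_contra hmem
    rw [Finset.mem_union, not_or] at hmem
    obtain ⟨huB, huC⟩ := hmem
    have hui : u ≠ i := fun e => huB (e ▸ hiB)
    have huj : u ≠ j := fun e => huC (e ▸ hjC)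
    have huA : u ∉ A := fun hmem => huB (hAB hmem)
    -- In terms of `r`: staying out of `C` means `h u A - h u C ≤ r u`, and joining `B ∪ C` for the
    -- thresholds reflected outside `B` means `r u < h u B - h u (B ∪ C)`.
    have hstay : reflectOutside h A r u ≤ hj u C := not_lt.1 fun hlt => huC (mem_cascade_of_lt mj hlt)
    rw [reflectOutside, if_neg huA, hhj, Function.update_of_ne huj] at hstay
    rw [reflectOutside, if_neg huB, hhij, Function.update_of_ne huj, hhi,
      Function.update_of_ne hui] at hu
    have := hsup u A B C hAB
    rw [Finset.union_eq_right.2 hAC] at this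
    linarith
  have h₁ := hW_mono hD
  have h₂ := hW_mono (Finset.subset_inter hAB hAC)
  have h₃ := hW_sub.union_add_inter_le B C
  change W (cascade hij (reflectOutside hi B r)) + W A ≤ W B + W C
  linarith

/-! ### Dependence on scaling factors of the resistances -/

/-- The expected value of the cascade with resistances `q u * k u A`, as a function of the scaling
factors `q`. -/
noncomputable def scaledValue (k : V → Finset V → ℝ) (W : Finset V → ℝ) (q : V → ℝ) : ℝ :=
  ∫ r, W (cascade (fun u A => q u * k u A) r) ∂(DemandModel.tradeoffLaw V)

/-- The factors for which the scaled resistances of `u` lie in `[0, 1]`, the range of the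
thresholds. -/
def scalings (k : V → Finset V → ℝ) (u : V) : Set ℝ :=
  {t | 0 ≤ t ∧ ∀ A, t * k u A ≤ 1}

omit [Fintype V] [DecidableEq V] in
theorem zero_mem_scalings (k : V → Finset V → ℝ) (u : V) : (0 : ℝ) ∈ scalings k u :=
  ⟨le_rfl, fun A => by simp⟩

omit [Fintype V] in
theorem update_mem_pi {D : V → Set ℝ} {q : V → ℝ} (hq : q ∈ Set.univ.pi D) {i : V} {t : ℝ}
    (ht : t ∈ D i) : Function.update q i t ∈ Set.univ.pi D := by
  intro u _
  rcases eq_or_ne u i with rfl | hu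
  · simpa using ht
  · simpa [hu] using hq u (Set.mem_univ u)

omit [Fintype V] in
theorem scale_update_zero (k : V → Finset V → ℝ) (q : V → ℝ) (i : V) :
    (fun u A => Function.update q i 0 u * k u A) =
      Function.update (fun u A => q u * k u A) i 0 := by
  funext u A
  rcases eq_or_ne u i with rfl | hu <;> simp [*]

/-- In each scaling factor, the expected value is affine and nonincreasing. -/
theorem exists_scaledValue_update_eq {k : V → Finset V → ℝ} (hk : ∀ u, Antitone (k u))
    (k0 : ∀ u A, 0 ≤ k u A) {W : Finset V → ℝ} (hW_mono : Monotone W) {q : V → ℝ}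
    (hq : q ∈ Set.univ.pi (scalings k)) (i : V) :
    ∃ b, 0 ≤ b ∧ ∀ t ∈ scalings k i,
      scaledValue k W (Function.update q i t) = scaledValue k W (Function.update q i 0) - b * t := by
  set h₀ : V → Finset V → ℝ := Function.update (fun u A => q u * k u A) i 0 with hh₀
  set A : (V → ℝ) → Finset V := fun r => cascade h₀ (Function.update r i 0) with hA
  set B : (V → ℝ) → Finset V := fun r => cascade h₀ (Function.update r i 1) with hB
  have hupd : ∀ t, Function.update (fun u A => Function.update q i t u * k u A) i 0 = h₀ := by
    intro t
    rw [← scale_update_zero, Function.update_idem, scale_update_zero]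
  have hanti : ∀ p ∈ Set.univ.pi (scalings k), ∀ u, Antitone fun A => p u * k u A :=
    fun p hp u X Y hXY => mul_le_mul_of_nonneg_left (hk u hXY) (hp u (Set.mem_univ u)).1
  have hval : ∀ t ∈ scalings k i, scaledValue k W (Function.update q i t) =
      ∫ r, (W (B r) - t * (k i (A r) * (W (B r) - W (A r)))) ∂(DemandModel.tradeoffLaw V) := by
    intro t ht
    have hqt := update_mem_pi hq ht
    rw [scaledValue, integral_cascade_eq (hanti _ hqt)
      (fun u X => mul_nonneg (hqt u (Set.mem_univ u)).1 (k0 u X))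
      (fun u X => (hqt u (Set.mem_univ u)).2 X) W i, hupd t]
    simp only [Function.update_self, mul_assoc, hA, hB]
  have hmeas : ∀ (s : ℝ) (φ : Finset V → ℝ),
      Measurable fun r => φ (cascade h₀ (Function.update r i s)) := by
    intro s φ
    refine (measurable_comp_cascade h₀ φ).comp (measurable_pi_lambda _ fun u => ?_)
    rcases eq_or_ne u i with rfl | hu
    · simp
    · simpa [hu] using measurable_pi_apply u
  have hint : ∀ (s : ℝ) (φ : Finset V → ℝ), Integrable
      (fun r => φ (cascade h₀ (Function.update r i s))) (DemandModel.tradeoffLaw V) :=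
    fun s φ => Integrable.of_bound (hmeas s φ).aestronglyMeasurable (∑ T, |φ T|)
      (Filter.Eventually.of_forall fun r =>
        Finset.single_le_sum (f := fun T => |φ T|) (fun _ _ => abs_nonneg _) (Finset.mem_univ _))
  have hintB : Integrable (fun r => W (B r)) (DemandModel.tradeoffLaw V) := hint 1 W
  have hintP : Integrable (fun r => k i (A r) * (W (B r) - W (A r)))
      (DemandModel.tradeoffLaw V) := by
    refine Integrable.of_bound ((hmeas 0 (k i)).mul
      ((hmeas 1 W).sub (hmeas 0 W))).aestronglyMeasurable
      (∑ S, ∑ T, |k i S * (W T - W S)|) (Filter.Eventually.of_forall fun r => ?_)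
    refine le_trans ?_ (Finset.single_le_sum (f := fun S => ∑ T, |k i S * (W T - W S)|)
      (fun _ _ => Finset.sum_nonneg fun _ _ => abs_nonneg _) (Finset.mem_univ (A r)))
    exact Finset.single_le_sum (f := fun T => |k i (A r) * (W T - W (A r))|)
      (fun _ _ => abs_nonneg _) (Finset.mem_univ (B r))
  refine ⟨∫ r, k i (A r) * (W (B r) - W (A r)) ∂(DemandModel.tradeoffLaw V), ?_, fun t ht => ?_⟩
  · refine integral_nonneg fun r => mul_nonneg (k0 i _) (sub_nonneg.2 (hW_mono ?_))
    refine cascade_subset fun u hu => mem_cascade_of_lt ?_ (hu.trans_le ?_)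
    · exact antitone_update_zero (hanti q hq) i
    · rcases eq_or_ne u i with rfl | hu <;> simp [*]
  · rw [hval t ht, hval 0 (zero_mem_scalings k i), integral_sub hintB (hintP.const_mul t),
      integral_const_mul]
    simp [mul_comm]

/-- In two distinct scaling factors, the expected value is a polynomial of degree one in each, and
the coefficient of the mixed term is nonpositive by submodularity. -/
theorem exists_scaledValue_update_update_eq {k : V → Finset V → ℝ} (hk : ∀ u, Antitone (k u))
    (k0 : ∀ u A, 0 ≤ k u A)
    (hsup : ∀ u A B C, A ⊆ B → k u B - k u (B ∪ C) ≤ k u A - k u (A ∪ C))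
    {W : Finset V → ℝ} (hW_mono : Monotone W) (hW_sub : IsSubmodular W) {q : V → ℝ}
    (hq : q ∈ Set.univ.pi (scalings k)) {i j : V} (hij : i ≠ j) (hqi : 0 < q i) (hqj : 0 < q j) :
    ∃ a b c d : ℝ, d ≤ 0 ∧ ∀ s ∈ scalings k i, ∀ t ∈ scalings k j,
      scaledValue k W (Function.update (Function.update q i s) j t) =
        a + b * s + c * t + d * (s * t) := by
  set G : ℝ → ℝ → ℝ := fun s t => scaledValue k W (Function.update (Function.update q i s) j t)
    with hG
  have hi := hq i (Set.mem_univ i)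
  have hj := hq j (Set.mem_univ j)
  have lin : ∀ s ∈ scalings k i, ∃ b, ∀ t ∈ scalings k j, G s t = G s 0 - b * t := fun s hs =>
    (exists_scaledValue_update_eq hk k0 hW_mono (update_mem_pi hq hs) j).imp fun b hb => hb.2
  have lin' : ∀ t ∈ scalings k j, ∃ b, ∀ s ∈ scalings k i, G s t = G 0 t - b * s := by
    intro t ht
    obtain ⟨b, -, hb⟩ := exists_scaledValue_update_eq hk k0 hW_mono (update_mem_pi hq ht) i
    refine ⟨b, fun s hs => ?_⟩
    simp only [hG]
    rw [Function.update_comm hij, Function.update_comm hij]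
    exact hb s hs
  have hsubm : G 0 0 + G (q i) (q j) ≤ G 0 (q j) + G (q i) 0 := by
    have := integral_cascade_submodular (h := fun u A => q u * k u A)
      (fun u X Y hXY => mul_le_mul_of_nonneg_left (hk u hXY) (hq u (Set.mem_univ u)).1)
      (fun u X => mul_nonneg (hq u (Set.mem_univ u)).1 (k0 u X))
      (fun u X => (hq u (Set.mem_univ u)).2 X)
      (fun u A B C hAB => by
        have := mul_le_mul_of_nonneg_left (hsup u A B C hAB) (hq u (Set.mem_univ u)).1
        linarith)
      hW_mono hW_sub i j
    simp only [← scale_update_zero] at this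
    have e : Function.update (Function.update q i 0) j (q j) = Function.update q i 0 := by
      rw [Function.update_eq_self_iff, Function.update_of_ne hij.symm]
    simp only [hG, e, Function.update_eq_self]
    exact this
  -- Interpolation from the values at the corners of the rectangle spanned by `0` and `(q i, q j)`.
  refine ⟨G 0 0, (G (q i) 0 - G 0 0) / q i, (G 0 (q j) - G 0 0) / q j,
    (G 0 0 + G (q i) (q j) - (G 0 (q j) + G (q i) 0)) / (q i * q j),
    div_nonpos_of_nonpos_of_nonneg (by linarith) (by positivity), fun s hs t ht => ?_⟩
  obtain ⟨b₁, hb₁⟩ := lin s hs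
  obtain ⟨b₂, hb₂⟩ := lin' 0 (zero_mem_scalings k j)
  obtain ⟨b₃, hb₃⟩ := lin' (q j) hj
  obtain ⟨b₄, hb₄⟩ := lin 0 (zero_mem_scalings k i)
  have e₁ := hb₁ t ht
  have e₂ := hb₁ (q j) hj
  have e₃ := hb₂ s hs
  have e₄ := hb₂ (q i) hi
  have e₅ := hb₃ s hs
  have e₆ := hb₃ (q i) hi
  change G s t = _
  have hb : b₁ = (G s 0 - G s (q j)) / q j := by
    rw [e₂]
    field_simp
    ring
  rw [e₁, hb, e₅, e₃, e₆, e₄]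
  field_simp
  ring

/-! ### The demand model as a threshold cascade -/

namespace DemandModel

/-- The cost that `u` bears when it joins the set `A` of sharing peers. -/
noncomputable def joinCost (M : DemandModel V) (u : V) (A : Finset V) : ℝ :=
  M.cost u * ∑ v, M.load (insert u A) v u

theorem joinCost_antitone (M : DemandModel V) (u : V) : Antitone (M.joinCost u) := fun _ _ h =>
  mul_le_mul_of_nonneg_left (Finset.sum_le_sum fun v _ => M.load_anti h v u) (M.cost_nonneg u)

omit [Fintype V] [DecidableEq V] in
theorem load_nonneg (M : DemandModel V) (A : Finset V) (v u : V) : 0 ≤ M.load A v u :=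
  div_nonneg (mul_nonneg (M.demand_nonneg v) (M.quality_nonneg v u))
    (Finset.sum_nonneg fun w _ => M.quality_nonneg v w)

theorem joinCost_nonneg (M : DemandModel V) (u : V) (A : Finset V) : 0 ≤ M.joinCost u A :=
  mul_nonneg (M.cost_nonneg u) (Finset.sum_nonneg fun v _ => M.load_nonneg _ v u)

omit [Fintype V] in
theorem load_insert_le_demand (M : DemandModel V) (A : Finset V) (v u : V) :
    M.load (insert u A) v u ≤ M.demand v := by
  unfold load
  rw [mul_div_assoc]
  refine mul_le_of_le_one_right (M.demand_nonneg v) (div_le_one_of_le₀ ?_ ?_)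
  · exact Finset.single_le_sum (f := M.quality v) (fun w _ => M.quality_nonneg v w)
      (Finset.mem_insert_self u A)
  · exact Finset.sum_nonneg fun w _ => M.quality_nonneg v w

theorem joinCost_le_maxCost (M : DemandModel V) (u : V) (A : Finset V) :
    M.joinCost u A ≤ M.maxCost u :=
  mul_le_mul_of_nonneg_left (Finset.sum_le_sum fun v _ => M.load_insert_le_demand A v u)
    (M.cost_nonneg u)

omit [Fintype V] in
/-- The load is a convex decreasing function of the total quality of the connections to the sharing
peers, so the relief from additional sharing peers diminishes. -/
theorem load_insert_supermodular (M : DemandModel V) (v u : V) {A B : Finset V} (C : Finset V)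
    (hAB : A ⊆ B) :
    M.load (insert u B) v u - M.load (insert u (B ∪ C)) v u ≤
      M.load (insert u A) v u - M.load (insert u (A ∪ C)) v u := by
  have h0 := M.quality_nonneg v
  have hle : ∀ {X Y : Finset V}, X ⊆ Y → ∑ w ∈ X, M.quality v w ≤ ∑ w ∈ Y, M.quality v w :=
    fun h => Finset.sum_le_sum_of_subset_of_nonneg h fun w _ _ => h0 w
  unfold load
  rcases (h0 u).eq_or_lt with hu | hu
  · simp [← hu]
  have hpos : ∀ X : Finset V, 0 < ∑ w ∈ insert u X, M.quality v w := fun X =>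
    Finset.sum_pos' (fun w _ => h0 w) ⟨u, Finset.mem_insert_self u X, hu⟩
  have hgain : ∀ X : Finset V, ∑ w ∈ insert u (X ∪ C), M.quality v w =
      ∑ w ∈ insert u X, M.quality v w + ∑ w ∈ C \ insert u X, M.quality v w := by
    intro X
    rw [← Finset.sum_union Finset.disjoint_sdiff, Finset.union_sdiff_self_eq_union,
      Finset.insert_union]
  have hd := hle (Finset.sdiff_subset_sdiff subset_rfl (Finset.insert_subset_insert u hAB) :
    C \ insert u B ⊆ C \ insert u A)
  have hx := hle (Finset.insert_subset_insert u hAB)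
  have hy := hle (Finset.insert_subset_insert u (Finset.union_subset_union_left (t := C) hAB))
  have hz : 0 ≤ ∑ w ∈ C \ insert u A, M.quality v w := Finset.sum_nonneg fun w _ => h0 w
  have hrel : ∀ X : Finset V, M.demand v * M.quality v u / ∑ w ∈ insert u X, M.quality v w -
      M.demand v * M.quality v u / ∑ w ∈ insert u (X ∪ C), M.quality v w =
      M.demand v * M.quality v u * ((∑ w ∈ C \ insert u X, M.quality v w) /
        ((∑ w ∈ insert u X, M.quality v w) * ∑ w ∈ insert u (X ∪ C), M.quality v w)) := by
    intro X
    rw [div_sub_div _ _ (hpos X).ne' (hpos (X ∪ C)).ne', ← mul_div_assoc]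
    congr 1
    rw [hgain X]
    ring
  rw [hrel A, hrel B]
  refine mul_le_mul_of_nonneg_left ?_ (mul_nonneg (M.demand_nonneg v) (h0 u))
  exact div_le_div₀ hz hd (mul_pos (hpos A) (hpos _)) (mul_le_mul hx hy (hpos _).le (hpos _).le)

theorem joinCost_supermodular (M : DemandModel V) (u : V) (A B C : Finset V) (hAB : A ⊆ B) :
    M.joinCost u B - M.joinCost u (B ∪ C) ≤ M.joinCost u A - M.joinCost u (A ∪ C) := by
  unfold joinCost
  rw [← mul_sub, ← mul_sub, ← Finset.sum_sub_distrib, ← Finset.sum_sub_distrib]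
  exact mul_le_mul_of_nonneg_left
    (Finset.sum_le_sum fun v _ => M.load_insert_supermodular v u C hAB) (M.cost_nonneg u)

theorem finalSet_eq_cascade (M : DemandModel V) {pay : V → ℝ} (hpay : ∀ u, 0 < pay u)
    (r : V → ℝ) : M.finalSet pay r = cascade (fun u A => (pay u)⁻¹ * M.joinCost u A) r := by
  have hmem : ∀ u A, u ∈ M.step pay r A ↔ (pay u)⁻¹ * M.joinCost u A < r u := by
    intro u A
    rw [inv_mul_lt_iff₀ (hpay u), mul_comm]
    simp [step, utility, joinCost]
  have hanti : ∀ u, Antitone fun A => (pay u)⁻¹ * M.joinCost u A := fun u A B h =>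
    mul_le_mul_of_nonneg_left (M.joinCost_antitone u h) (inv_nonneg.2 (hpay u).le)
  refine Finset.Subset.antisymm ?_ (cascade_subset fun u hu => ?_)
  · have : ∀ t, (M.step pay r)^[t] ∅ ⊆
        cascade (fun u A => (pay u)⁻¹ * M.joinCost u A) r := by
      intro t
      induction t with
      | zero => exact Finset.empty_subset _
      | succ t ih =>
        rw [Function.iterate_succ_apply']
        intro u hu
        exact mem_cascade_of_lt hanti ((hmem u _).1 (M.step_mono pay r ih hu))
    exact this _
  · rw [← M.step_finalSet]
    exact (hmem u _).2 hu

theorem expectedWelfare_eq_scaledValue (M : DemandModel V) (W : Finset V → ℝ) {pay : V → ℝ}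
    (hpay : pay ∈ Set.univ.pi M.offers) :
    M.expectedWelfare W pay = scaledValue M.joinCost W fun u => (pay u)⁻¹ := by
  simp only [expectedWelfare, scaledValue,
    M.finalSet_eq_cascade fun u => (hpay u (Set.mem_univ u)).2]

theorem inv_mem_scalings (M : DemandModel V) {u : V} {t : ℝ} (ht : t ∈ M.offers u) :
    t⁻¹ ∈ scalings M.joinCost u := by
  refine ⟨inv_nonneg.2 ht.2.le, fun A => ?_⟩
  rw [inv_mul_le_iff₀ ht.2, mul_one]
  exact (M.joinCost_le_maxCost u A).trans ht.1

omit [Fintype V] in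
theorem inv_update (x : V → ℝ) (i : V) (t : ℝ) :
    (fun u => (Function.update x i t u)⁻¹) = Function.update (fun u => (x u)⁻¹) i t⁻¹ := by
  funext u
  rcases eq_or_ne u i with rfl | hu <;> simp [*]

omit [DecidableEq V] in
theorem uniqueDiffWithinAt_offers (M : DemandModel V) {u : V} {t : ℝ} (ht : t ∈ M.offers u) :
    UniqueDiffWithinAt ℝ (M.offers u) t :=
  (uniqueDiffWithinAt_Ici t).mono fun _ hs => ⟨ht.1.trans hs, ht.2.trans_le hs⟩

end DemandModel

/-! ### Derivatives -/

theorem hasDerivWithinAt_const_add_mul_inv {f : ℝ → ℝ} {D : Set ℝ} {a c t : ℝ} (ht : t ∈ D)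
    (ht0 : t ≠ 0) (hf : ∀ s ∈ D, f s = a + c * s⁻¹) :
    HasDerivWithinAt f (-c / t ^ 2) D t := by
  have h := (((hasDerivAt_inv ht0).const_mul c).const_add a).hasDerivWithinAt (s := D)
  refine (h.congr hf (hf t ht)).congr_deriv ?_
  ring

omit [Fintype V] in
theorem partialDerivOn_eq {D : V → Set ℝ} {j : V} {g : (V → ℝ) → ℝ} {x : V → ℝ} {d : ℝ}
    (h : HasDerivWithinAt (fun t => g (Function.update x j t)) d (D j) (x j))
    (hu : UniqueDiffWithinAt ℝ (D j) (x j)) : partialDerivOn D j g x = d :=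
  h.derivWithin hu

end

theorem theorem1 {V : Type*} [Fintype V] [DecidableEq V] (M : DemandModel V)
    (W : Finset V → ℝ) (hW_mono : Monotone W) (hW_sub : IsSubmodular W) :
    (∀ pay ∈ Set.univ.pi M.offers,
      Integrable (fun r => W (M.finalSet pay r)) (DemandModel.tradeoffLaw V)) ∧
    MonotoneOn (M.expectedWelfare W) (Set.univ.pi M.offers) ∧
    DiminishingReturnsOn M.offers (M.expectedWelfare W) := by
  have hint : ∀ pay ∈ Set.univ.pi M.offers,
      Integrable (fun r => W (M.finalSet pay r)) (DemandModel.tradeoffLaw V) := by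
    intro pay hpay
    simp only [M.finalSet_eq_cascade fun u => (hpay u (Set.mem_univ u)).2]
    exact integrable_tradeoffLaw_comp_cascade (fun u A => (pay u)⁻¹ * M.joinCost u A) W
  refine ⟨hint, fun x hx y hy hxy => ?_, fun x hx i j => ?_⟩
  · have hx0 : ∀ u, 0 < x u := fun u => (hx u (Set.mem_univ u)).2
    have hy0 : ∀ u, 0 < y u := fun u => (hy u (Set.mem_univ u)).2
    refine integral_mono (hint x hx) (hint y hy) fun r => hW_mono ?_
    rw [M.finalSet_eq_cascade hx0, M.finalSet_eq_cascade hy0]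
    exact cascade_subset_cascade (h := fun u A => (x u)⁻¹ * M.joinCost u A)
      (h' := fun u A => (y u)⁻¹ * M.joinCost u A)
      (fun u A B h => mul_le_mul_of_nonneg_left (M.joinCost_antitone u h) (inv_nonneg.2 (hy0 u).le))
      (fun u A => mul_le_mul_of_nonneg_right (inv_anti₀ (hx0 u) (hxy u)) (M.joinCost_nonneg u A)) r
  · have hinv : ∀ y ∈ Set.univ.pi M.offers,
        (fun u => (y u)⁻¹) ∈ Set.univ.pi (scalings M.joinCost) :=
      fun y hy u hu => M.inv_mem_scalings (hy u hu)
    have h0 : ∀ u, 0 < x u := fun u => (hx u (Set.mem_univ u)).2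
    have hxi := hx i (Set.mem_univ i)
    have hxj := hx j (Set.mem_univ j)
    obtain ⟨b, hb0, hb⟩ := exists_scaledValue_update_eq M.joinCost_antitone M.joinCost_nonneg
      hW_mono (hinv x hx) j
    have hline : ∀ t ∈ M.offers j, M.expectedWelfare W (Function.update x j t) =
        scaledValue M.joinCost W (Function.update (fun u => (x u)⁻¹) j 0) + -b * t⁻¹ := by
      intro t ht
      rw [M.expectedWelfare_eq_scaledValue W (update_mem_pi hx ht), DemandModel.inv_update,
        hb _ (M.inv_mem_scalings ht)]
      ring
    refine ⟨(hasDerivWithinAt_const_add_mul_inv hxj (h0 j).ne' hline).differentiableWithinAt, ?_⟩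
    suffices hsecond : ∃ d ≤ 0, HasDerivWithinAt
        (fun s => partialDerivOn M.offers j (M.expectedWelfare W) (Function.update x i s)) d
        (M.offers i) (x i) by
      obtain ⟨d, hd, hder⟩ := hsecond
      exact ⟨hder.differentiableWithinAt,
        (partialDerivOn_eq hder (M.uniqueDiffWithinAt_offers hxi)).trans_le hd⟩
    rcases eq_or_ne i j with rfl | hij
    · have hfirst : ∀ s ∈ M.offers i, partialDerivOn M.offers i (M.expectedWelfare W)
          (Function.update x i s) = b * (s ^ 2)⁻¹ := by
        intro s hs
        refine partialDerivOn_eq ?_ (by simpa using M.uniqueDiffWithinAt_offers hs)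
        simp only [Function.update_idem, Function.update_self]
        exact (hasDerivWithinAt_const_add_mul_inv hs hs.2.ne' hline).congr_deriv (by ring)
      have hder := (((hasDerivAt_pow 2 (x i)).inv (pow_ne_zero 2 (h0 i).ne')).const_mul
        b).hasDerivWithinAt (s := M.offers i)
      refine ⟨_, ?_, hder.congr hfirst (hfirst _ hxi)⟩
      refine mul_nonpos_of_nonneg_of_nonpos hb0 (div_nonpos_of_nonpos_of_nonneg ?_ (by positivity))
      have := h0 i
      simp only [Left.neg_nonpos_iff]
      positivity
    · obtain ⟨a, b', c, d, hd, hG⟩ := exists_scaledValue_update_update_eq M.joinCost_antitone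
        M.joinCost_nonneg M.joinCost_supermodular hW_mono hW_sub (hinv x hx) hij
        (inv_pos.2 (h0 i)) (inv_pos.2 (h0 j))
      have hfirst : ∀ s ∈ M.offers i, partialDerivOn M.offers j (M.expectedWelfare W)
          (Function.update x i s) = -c / x j ^ 2 + -d / x j ^ 2 * s⁻¹ := by
        intro s hs
        have hxs := update_mem_pi hx hs
        have e : Function.update x i s j = x j := Function.update_of_ne hij.symm _ _
        refine partialDerivOn_eq ?_ (by rw [e]; exact M.uniqueDiffWithinAt_offers hxj)
        rw [e]
        refine (hasDerivWithinAt_const_add_mul_inv (a := a + b' * s⁻¹) (c := c + d * s⁻¹) hxj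
          (h0 j).ne' fun t ht => ?_).congr_deriv (by ring)
        rw [M.expectedWelfare_eq_scaledValue W (update_mem_pi hxs ht), DemandModel.inv_update,
          DemandModel.inv_update, hG _ (M.inv_mem_scalings hs) _ (M.inv_mem_scalings ht)]
        ring
      refine ⟨_, ?_, hasDerivWithinAt_const_add_mul_inv hxi (h0 i).ne' hfirst⟩
      rw [neg_div, neg_div, neg_div, neg_neg]
      exact div_nonpos_of_nonpos_of_nonneg (div_nonpos_of_nonpos_of_nonneg hd (sq_nonneg _))
        (sq_nonneg _)
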